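/- Let $\Gamma=(N,(Y_i)_{i\in N},(u_i)_{i\in N})$ be a finite normal form game. For a tuple $p=(p_i)_{i\in N}$ of vectors $p_i\in\mathbb R^{Y_i}$ put $U_i(p)=\sum_{y\in\prod_j Y_j}u_i(y)\prod_j p_j(y_j)$; let $\Delta_i\subset\mathbb R^{Y_i}$ be the simplex of mixed strategies of player $i$, $A_i$ its set of vertices (pure strategies, identified with actions), and $NE$ the set of mixed-strategy Nash equilibria. Assume that $\Gamma$ is an exact potential game with potential $\Phi:\prod_i Y_i\to\mathbb R$, i.e. $u_i(y_i',y_{-i})-u_i(y_i'',y_{-i})=\Phi(y_i',y_{-i})-\Phi(y_i'',y_{-i})$ for all $i,y_i',y_i'',y_{-i}$. Let $\mathcal P=\{P_k\}_{k\in I}$ be a permutation invariant partition of $N$: the $P_k$ are nonempty, pairwise disjoint, cover $N$, and for $i,j$ in the same class $Y_i=Y_j$ and $\Phi$ is unchanged when $i$ and $j$ exchange their actions. Let $\psi(i)$ be the index of the class of $i$, and let $SNE=\{p\in NE: p_i=p_j \text{ whenever } i,j \text{ lie in the same class}\}$. For a sequence of joint actions $a(t)$, $t\ge1$, put $q_i(t)=\frac1t\sum_{s=1}^t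 a_i(s)$, $\bar g^k(t)=|P_k|^{-1}\sum_{i\in P_k}q_i(t)$ and $\bar g(t)=(\bar g^{\psi(i)}(t))_{i\in N}$ (the composite empirical centroid distribution). Let each player $i$ hold estimates $\hat g_i^k(t)$ of $\bar g^k(t)$ (arbitrary vectors, not necessarily in a simplex) with $\|\hat g_i^k(t)-\bar g^k(t)\|=O(\log t/t)$ for all $i\in N$, $k\in I$. Suppose $\{a(t)\}$ is an ECFP process with respect to $\mathcal P$: for all $t\ge1$ and $i\in N$, $$a_i(t+1)\in\arg\max_{\alpha_i\in A_i}U_i\bigl(\alpha_i,(\hat g_i^{\psi(j)}(t))_{j\ne i}\bigr),$$ with $a(1)$ arbitrary; or suppose that the same holds for all $t\ge1$ with $a_i(t)$ in place of $a_i(t+1)$. Then $SNE\neq\emptyset$ and $d(\bar g(t),SNE)\to0$ as $t\to\infty$, where $d$ is the Euclidean distance. Classical fictitious play, $a_i(t+1)\in\arg\max_{\alpha_i\in A_i}U_i(\alpha_i,q_{-i}(t))$, is the special case of one player per class: the partition of $N$ into single players is permutation invariant, and for any partition with one player per class $SNE=NE$, $\bar g(t)=q(t)$, and the fictitious play processes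 are exactly the ECFP processes (in the form with $a_i(t+1)$) with exact estimates $\hat g_i^k(t)=\bar g^k(t)$. In particular $NE\ne\emptyset$ and $d(q(t),NE)\to0$ for every fictitious play process. -/

import Mathlib

open Filter Asymptotics

noncomputable section

namespace ECFP

/-- A finite normal form game with player set `N`. The action space of player `i` is a finite
set `Y i`; all action spaces are subsets of one finite set `𝒜` of labels, so that it makes sense
to say that two players have the same action space. Utilities are functions on `∏ i, Y i`. -/
structure Game (N 𝒜 : Type*) where
  Y : N → Finset 𝒜
  u : N → (∀ i, Y i) → ℝ

/-- `ℝ^𝒜`, in which the space of vectors indexed by `Y i` sits as the coordinate subspace of the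
vectors vanishing off `Y i`. -/
abbrev Vec (𝒜 : Type*) := EuclideanSpace ℝ 𝒜

namespace Game

variable {N I 𝒜 : Type*} [Fintype N] [DecidableEq N] [Fintype 𝒜] [DecidableEq 𝒜]

/-- Joint actions. -/
abbrev Joint (Γ : Game N 𝒜) := ∀ i, Γ.Y i

/-- The simplex `Δ_i` of mixed strategies of player `i`. -/
def simplex (Γ : Game N 𝒜) (i : N) : Set (Vec 𝒜) :=
  {p | (∀ a, 0 ≤ p a) ∧ (∀ a, a ∉ Γ.Y i → p a = 0) ∧ ∑ a ∈ Γ.Y i, p a = 1}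

/-- The pure strategy (canonical basis vector) that belongs to an action. -/
def vertex (Γ : Game N 𝒜) {i : N} (y : Γ.Y i) : Vec 𝒜 := EuclideanSpace.single (y : 𝒜) 1

/-- The multilinear extension of `u i`, as a function of arbitrary tuples of vectors (estimates
are allowed to leave the simplex). -/
def U (Γ : Game N 𝒜) (i : N) (p : N → Vec 𝒜) : ℝ :=
  ∑ y : Γ.Joint, Γ.u i y * ∏ j, p j (y j : 𝒜)

/-- Nash equilibria in mixed strategies. -/
def NE (Γ : Game N 𝒜) : Set (N → Vec 𝒜) :=
  {p | (∀ i, p i ∈ Γ.simplex i) ∧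
    ∀ i, ∀ g ∈ Γ.simplex i, Γ.U i (Function.update p i g) ≤ Γ.U i p}

/-- `Φ` is an exact potential function. -/
def IsPotential (Γ : Game N 𝒜) (Φ : Γ.Joint → ℝ) : Prop :=
  ∀ (i : N) (y : Γ.Joint) (y' y'' : Γ.Y i),
    Γ.u i (Function.update y i y') - Γ.u i (Function.update y i y'') =
      Φ (Function.update y i y') - Φ (Function.update y i y'')

/-- A partition of the players into nonempty classes `part k`, such that players of one class have
the same action space and `Φ` does not change when two of them exchange their actions. -/
structure PermInvPartition (Γ : Game N 𝒜) (Φ : Γ.Joint → ℝ) (I : Type*) where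
  part : I → Finset N
  nonempty : ∀ k, (part k).Nonempty
  disjoint : ∀ k l, k ≠ l → Disjoint (part k) (part l)
  cover : ∀ i, ∃ k, i ∈ part k
  same_actions : ∀ k, ∀ i ∈ part k, ∀ j ∈ part k, Γ.Y i = Γ.Y j
  invariant : ∀ k, ∀ i ∈ part k, ∀ j ∈ part k, ∀ y z : Γ.Joint,
    (z i : 𝒜) = y j → (z j : 𝒜) = y i → (∀ l, l ≠ i → l ≠ j → z l = y l) → Φ z = Φ y

namespace PermInvPartition

variable {Γ : Game N 𝒜} {Φ : Γ.Joint → ℝ}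

/-- The class of a player. -/
def ψ (P : Γ.PermInvPartition Φ I) (i : N) : I := Classical.choose (P.cover i)

theorem ψ_eq_iff (P : Γ.PermInvPartition Φ I) (i : N) (k : I) : P.ψ i = k ↔ i ∈ P.part k := by
  have h : i ∈ P.part (P.ψ i) := Classical.choose_spec (P.cover i)
  constructor
  · rintro rfl
    exact h
  · intro hk
    by_contra hne
    exact Finset.disjoint_left.1 (P.disjoint _ _ hne) h hk

/-- Symmetric Nash equilibria relative to the partition. -/
def SNE (P : Γ.PermInvPartition Φ I) : Set (N → Vec 𝒜) :=
  {p | p ∈ Γ.NE ∧ ∀ k, ∀ i ∈ P.part k, ∀ j ∈ P.part k, p i = p j}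

end PermInvPartition

/-- The empirical distribution of the actions of player `i` at the stages `1, …, t`. Stages are
numbered from `1`; the entry `a 0` of a sequence of joint actions is never used. -/
def q (Γ : Game N 𝒜) (a : ℕ → Γ.Joint) (t : ℕ) (i : N) : Vec 𝒜 :=
  (t : ℝ)⁻¹ • ∑ s ∈ Finset.Icc 1 t, Γ.vertex (a s i)

/-- Fictitious play; the action at stage `1` is arbitrary. -/
def IsFP (Γ : Game N 𝒜) (a : ℕ → Γ.Joint) : Prop :=
  ∀ t, 1 ≤ t → ∀ (i : N) (α : Γ.Y i),
    Γ.U i (Function.update (Γ.q a t) i (Γ.vertex α)) ≤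
      Γ.U i (Function.update (Γ.q a t) i (Γ.vertex (a (t + 1) i)))

namespace PermInvPartition

variable {Γ : Game N 𝒜} {Φ : Γ.Joint → ℝ}

/-- The empirical centroid distribution of class `k`. -/
def centroid (P : Γ.PermInvPartition Φ I) (a : ℕ → Γ.Joint) (t : ℕ) (k : I) : Vec 𝒜 :=
  ((P.part k).card : ℝ)⁻¹ • ∑ i ∈ P.part k, Γ.q a t i

/-- The composite empirical centroid distribution. -/
def composite (P : Γ.PermInvPartition Φ I) (a : ℕ → Γ.Joint) (t : ℕ) : N → Vec 𝒜 :=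
  fun i => P.centroid a t (P.ψ i)

/-- `a` is an ECFP process with respect to `P` and the estimates `ĝ t i k` (the estimate, held by
player `i` at stage `t`, of the centroid of class `k`): `a_i(t + s)` is a best response to the
estimates of stage `t`. For `s = 1` players respond to the estimates of the preceding
stage and the first action is arbitrary; for `s = 0` they respond to those of the same stage. -/
def IsECFP (P : Γ.PermInvPartition Φ I) (s : ℕ) (ĝ : ℕ → N → I → Vec 𝒜)
    (a : ℕ → Γ.Joint) : Prop :=
  ∀ t, 1 ≤ t → ∀ (i : N) (α : Γ.Y i),
    Γ.U i (Function.update (fun j => ĝ t i (P.ψ j)) i (Γ.vertex α)) ≤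
      Γ.U i (Function.update (fun j => ĝ t i (P.ψ j)) i (Γ.vertex (a (t + s) i)))

end PermInvPartition

end Game

/-- Distance from a tuple to a set of tuples for the Euclidean norm of the product space. -/
def dist₂ {N 𝒜 : Type*} [Fintype N] [Fintype 𝒜] (p : N → Vec 𝒜) (S : Set (N → Vec 𝒜)) : ℝ :=
  Metric.infDist (WithLp.toLp 2 p : PiLp 2 fun _ : N => Vec 𝒜)
    {p' : PiLp 2 fun _ : N => Vec 𝒜 | (p' : N → Vec 𝒜) ∈ S}

end ECFP

end

set_option linter.unusedSectionVars false

/-! Let `V` be the multilinear extension of the potential and `g t` the composite centroid. The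
centroid moves by `(t + 1)⁻¹ • (r - g t)`, where `r` is the class average of the vertices played at
stage `t + 1`. Expanding `V` to first order (`exists_le_map_add_smul`), `V (g t)` grows by `1 / (t +
1)` times the sum over players of the unilateral changes towards `r`, up to `O(1/t²)`.

Permutation invariance makes this sum, at a symmetric profile, equal to the sum of the changes when
each player switches to the vertex actually played (`sum_ext_update_classAverage`). That vertex is a
best response to the estimates, hence a best response to `g t` up to a multiple of the estimation
error, so the sum dominates the gain of any one deviation up to such errors.

The errors are summable against `1/t`, because `log t / t²` is summable, and `V (g t)` is bounded.
So for each deviation the sum of gain divided by `t + 1` is finite. The gain changes by only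
`O(1/t)` per stage, which upgrades summability to convergence to `0`
(`tendsto_zero_of_summable_div`). Symmetric profiles form a compact set and those without gains are
symmetric equilibria; this gives both existence and convergence. -/

namespace ECFP

/-! ### Real sequences and limits in compact sets -/

/-- A nonnegative sequence with increments `O(1/t)` whose sum against `1/t` is finite tends to `0`:
its square has summable increments. -/
theorem tendsto_zero_of_summable_div {x : ℕ → ℝ} {C : ℝ} (h0 : ∀ t, 0 ≤ x t)
    (hd : ∀ t : ℕ, |x (t + 1) - x t| ≤ C / (t + 1))
    (hs : Summable fun t : ℕ => x t / (t + 1)) : Tendsto x atTop (nhds 0) := by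
  have hC : 0 ≤ C := by simpa using (abs_nonneg _).trans (hd 0)
  have hsq : Summable fun t : ℕ => 1 / ((t : ℝ) + 1) ^ 2 := by
    simpa using (summable_nat_add_iff 1).2 (Real.summable_one_div_nat_pow.2 (one_lt_two))
  have hcau : CauchySeq fun t => x t ^ 2 := by
    refine cauchySeq_of_summable_dist (Summable.of_nonneg_of_le (fun _ => dist_nonneg) (fun t => ?_)
      ((hs.mul_left (2 * C)).add (hsq.mul_left (C ^ 2))))
    have hp : (0 : ℝ) < t + 1 := by positivity
    have h1 := hd t
    have h2 : x (t + 1) ≤ x t + C / (t + 1) := by linarith [le_abs_self (x (t + 1) - x t)]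
    rw [Real.dist_eq, abs_sub_comm]
    calc |x (t + 1) ^ 2 - x t ^ 2| = |x (t + 1) - x t| * (x (t + 1) + x t) := by
          rw [← abs_of_nonneg (add_nonneg (h0 (t + 1)) (h0 t)), ← abs_mul]
          congr 1
          ring
      _ ≤ C / (t + 1) * (x t + C / (t + 1) + x t) := by
          gcongr
          exact add_nonneg (h0 _) (h0 _)
      _ = _ := by field_simp; ring
  obtain ⟨l, hl⟩ := cauchySeq_tendsto_of_complete hcau
  have hl' : Tendsto x atTop (nhds (Real.sqrt l)) := by
    refine ((Real.continuous_sqrt.tendsto l).comp hl).congr fun t => ?_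
    simp [Real.sqrt_sq (h0 t)]
  rcases (Real.sqrt_nonneg l).eq_or_lt with h | h
  · rwa [← h] at hl'
  -- A positive limit would make the harmonic series converge by comparison.
  · exfalso
    have hev : ∀ᶠ t in atTop, Real.sqrt l / 2 < x t := hl'.eventually (lt_mem_nhds (half_lt_self h))
    have hO : (fun t : ℕ => 1 / ((t : ℝ) + 1)) =O[atTop] fun t : ℕ => x t / (t + 1) := by
      refine IsBigO.of_bound (Real.sqrt l / 2)⁻¹ ?_
      filter_upwards [hev] with t ht
      have hp : (0 : ℝ) < t + 1 := by positivity
      rw [Real.norm_of_nonneg (by positivity), Real.norm_of_nonneg (div_nonneg (h0 t) hp.le),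
        ← mul_div_assoc]
      gcongr
      rw [inv_mul_eq_div, le_div_iff₀ (by positivity)]
      linarith
    have := summable_of_isBigO_nat hs hO
    refine Real.not_summable_one_div_natCast ((summable_nat_add_iff 1).1 ?_)
    simpa using this

/-- Telescoping from a stage `T` on bounds all partial sums by `B - w T` plus the total of `|e|`; an
upper bound on `w` suffices. -/
theorem summable_of_le_increment {y w e : ℕ → ℝ} {B : ℝ} (h0 : ∀ t, 0 ≤ y t) (hw : ∀ t, w t ≤ B)
    (he : Summable e) (h : ∀ᶠ t in atTop, y t ≤ w (t + 1) - w t + e t) : Summable y := by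
  obtain ⟨T, hT⟩ := eventually_atTop.1 h
  rw [← summable_nat_add_iff T]
  have he' : Summable fun t => |e (t + T)| := ((summable_nat_add_iff T).2 he).abs
  refine summable_of_sum_range_le (c := B - w T + ∑' t, |e (t + T)|) (fun t => h0 _) fun n => ?_
  calc ∑ t ∈ Finset.range n, y (t + T)
      ≤ ∑ t ∈ Finset.range n, ((w (t + 1 + T) - w (t + T)) + |e (t + T)|) := by
        refine Finset.sum_le_sum fun t _ => ?_
        have := hT (t + T) (Nat.le_add_left _ _)
        rw [show t + 1 + T = t + T + 1 by ring]
        linarith [le_abs_self (e (t + T))]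
    _ = w (n + T) - w T + ∑ t ∈ Finset.range n, |e (t + T)| := by
        rw [Finset.sum_add_distrib, Finset.sum_range_sub (fun t => w (t + T))]
        simp
    _ ≤ _ := by
        gcongr
        · exact hw _
        · exact he'.sum_le_tsum _ fun t _ => abs_nonneg _

/-- A sequence in a compact set along which the continuous functions `S j` tend to `0` approaches
the common zeros of the `S j`. -/
theorem tendsto_zero_of_isCompact {X ι : Type*} [TopologicalSpace X] {K : Set X}
    (hK : IsCompact K) {x : ℕ → X} (hx : ∀ᶠ t in atTop, x t ∈ K) {S : ι → X → ℝ}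
    (hS : ∀ j, Continuous (S j)) (hSx : ∀ j, Tendsto (fun t => S j (x t)) atTop (nhds 0)) :
    (∃ p ∈ K, ∀ j, S j p = 0) ∧
      ∀ h : X → ℝ, Continuous h → (∀ p ∈ K, (∀ j, S j p = 0) → h p = 0) →
        Tendsto (fun t => h (x t)) atTop (nhds 0) := by
  -- Ultrafilters below `atTop` replace convergent subsequences: along each of them `x` has a limit
  -- in `K`, where every `S j` vanishes by continuity.
  have key : ∀ u : Ultrafilter ℕ, ↑u ≤ (atTop : Filter ℕ) →
      ∃ p ∈ K, (∀ j, S j p = 0) ∧ Tendsto x u (nhds p) := by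
    intro u hu
    obtain ⟨p, hp, hup⟩ := isCompact_iff_ultrafilter_le_nhds.1 hK (u.map x) (by
      rw [le_principal_iff]
      exact hu hx)
    have hup' : Tendsto x u (nhds p) := hup
    exact ⟨p, hp, fun j => tendsto_nhds_unique (((hS j).tendsto p).comp hup')
      ((hSx j).mono_left hu), hup'⟩
  refine ⟨?_, fun h hc h0 => ?_⟩
  · obtain ⟨p, hp, hz, -⟩ := key (Ultrafilter.of atTop) (Ultrafilter.of_le _)
    exact ⟨p, hp, hz⟩
  · rw [tendsto_iff_ultrafilter]
    intro u hu
    obtain ⟨p, hp, hz, hup⟩ := key u hu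
    rw [← h0 p hp hz]
    exact (hc.tendsto p).comp hup

/-- Since `log t = O(t ^ (1/2))`, the terms are `O(t ^ (-3/2))`. This is where the rate `log t / t`
of the estimates enters. -/
theorem summable_log_div_mul :
    Summable fun t : ℕ => Real.log t / t * (1 / ((t : ℝ) + 1)) := by
  refine summable_of_isBigO_nat (g := fun t : ℕ => 1 / (t : ℝ) ^ (3 / 2 : ℝ))
    (Real.summable_one_div_nat_rpow.2 (by norm_num)) ?_
  have h1 := ((isLittleO_log_rpow_atTop (r := 1 / 2) (by norm_num)).isBigO).comp_tendsto
    tendsto_natCast_atTop_atTop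
  obtain ⟨C, hC⟩ := h1.bound
  refine IsBigO.of_bound |C| ?_
  filter_upwards [hC, eventually_ge_atTop 1] with t ht h1t
  have hp : (0 : ℝ) < t := by exact_mod_cast h1t
  simp only [Function.comp_apply] at ht
  rw [norm_mul, norm_div, Real.norm_of_nonneg hp.le,
    Real.norm_of_nonneg (show (0 : ℝ) ≤ 1 / (t + 1) by positivity),
    Real.norm_of_nonneg (show (0 : ℝ) ≤ 1 / (t : ℝ) ^ (3 / 2 : ℝ) by positivity)]
  rw [Real.norm_of_nonneg (show (0 : ℝ) ≤ (t : ℝ) ^ (1 / 2 : ℝ) by positivity)] at ht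
  have h2 : (t : ℝ) ^ (3 / 2 : ℝ) * (t : ℝ) ^ (1 / 2 : ℝ) = t * t := by
    rw [← Real.rpow_add hp]; norm_num [sq]
  calc ‖Real.log t‖ / t * (1 / (t + 1)) ≤ (|C| * (t : ℝ) ^ (1 / 2 : ℝ)) / t * (1 / t) := by
        gcongr
        · exact ht.trans (by gcongr; exact le_abs_self C)
        · linarith
    _ = |C| * (1 / (t : ℝ) ^ (3 / 2 : ℝ)) := by
        field_simp
        linear_combination |C| * h2

theorem tendsto_log_div : Tendsto (fun t : ℕ => Real.log t / t) atTop (nhds 0) := by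
  have := (Real.isLittleO_log_id_atTop.tendsto_div_nhds_zero).comp
    (tendsto_natCast_atTop_atTop (R := ℝ))
  exact this

/-! ### First-order expansion of multilinear functions -/

section Multilinear

variable {N E : Type*} [Fintype N] [DecidableEq N] [NormedAddCommGroup E] [NormedSpace ℝ E]

/-- Moving from `p` a step `c` towards `r` changes a multilinear function to first order by `c`
times the sum of the changes under unilateral replacements. -/
theorem exists_le_map_add_smul {f : MultilinearMap ℝ (fun _ : N => E) ℝ} (hf : Continuous f) :
    ∃ C, ∀ p r : N → E, ‖p‖ ≤ 1 → ‖r‖ ≤ 1 → ∀ c : ℝ, 0 ≤ c → c ≤ 1 →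
      f p + c * ∑ i, (f (Function.update p i (r i)) - f p) - C * c ^ 2 ≤ f (p + c • (r - p)) := by
  obtain ⟨C, hC, hb⟩ := f.exists_bound_of_continuous hf
  -- The constant collects the terms in which at least two slots carry the increment; in the unit
  -- ball each such slot contributes a factor at most `2 * c`.
  refine ⟨∑ s : Finset N with 2 ≤ s.card, C * 2 ^ s.card, fun p r hp hr c hc0 hc1 => ?_⟩
  have hlin : f.linearDeriv p (c • (r - p)) =
      c * ∑ i, (f (Function.update p i (r i)) - f p) := by
    rw [map_smul, MultilinearMap.linearDeriv_apply, smul_eq_mul]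
    congr 1
    refine Finset.sum_congr rfl fun i _ => ?_
    rw [Pi.sub_apply, MultilinearMap.map_update_sub, Function.update_eq_self]
  rw [MultilinearMap.map_add_eq_map_add_linearDeriv_add, hlin, sub_eq_add_neg]
  gcongr
  rw [Finset.sum_mul, ← Finset.sum_neg_distrib]
  refine Finset.sum_le_sum fun s hs => neg_le_of_abs_le ?_
  have hs2 := (Finset.mem_filter.1 hs).2
  rw [← Real.norm_eq_abs]
  refine (hb _).trans ?_
  rw [mul_assoc]
  gcongr
  have hpi : ∀ i, ‖p i‖ ≤ 1 := fun i => (norm_le_pi_norm p i).trans hp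
  have hri : ∀ i, ‖r i‖ ≤ 1 := fun i => (norm_le_pi_norm r i).trans hr
  calc ∏ i, ‖s.piecewise (c • (r - p)) p i‖ ≤ ∏ i, if i ∈ s then 2 * c else 1 := by
        refine Finset.prod_le_prod (fun _ _ => norm_nonneg _) fun i _ => ?_
        by_cases hi : i ∈ s
        · simp only [hi, Finset.piecewise_eq_of_mem, if_true, Pi.smul_apply, Pi.sub_apply,
            norm_smul, Real.norm_of_nonneg hc0]
          nlinarith [norm_sub_le (r i) (p i), hpi i, hri i]
        · simpa [hi] using hpi i
    _ = 2 ^ s.card * c ^ s.card := by simp [Finset.prod_ite_mem, mul_pow]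
    _ ≤ 2 ^ s.card * c ^ 2 := by
        gcongr 2 ^ s.card * ?_
        exact pow_le_pow_of_le_one hc0 hc1 hs2

end Multilinear

end ECFP

/-! ### Multilinear extensions, potentials and simplices -/

namespace ECFP.Game

variable {N I 𝒜 : Type*} [Fintype N] [DecidableEq N] [Fintype 𝒜] [DecidableEq 𝒜]

/-- The multilinear extension of a function of joint actions. -/
noncomputable def ext (Γ : Game N 𝒜) (f : Γ.Joint → ℝ) : MultilinearMap ℝ (fun _ : N => Vec 𝒜) ℝ :=
  ∑ y : Γ.Joint, f y • (MultilinearMap.mkPiAlgebra ℝ N ℝ).compLinearMap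
    fun j => (EuclideanSpace.proj (y j : 𝒜) : Vec 𝒜 →L[ℝ] ℝ).toLinearMap

theorem ext_apply (Γ : Game N 𝒜) (f : Γ.Joint → ℝ) (p : N → Vec 𝒜) :
    Γ.ext f p = ∑ y : Γ.Joint, f y * ∏ j, p j (y j : 𝒜) := by
  simp [ext]

theorem U_eq_ext (Γ : Game N 𝒜) (i : N) (p : N → Vec 𝒜) : Γ.U i p = Γ.ext (Γ.u i) p :=
  (Γ.ext_apply _ p).symm

theorem contDiff_ext (Γ : Game N 𝒜) (f : Γ.Joint → ℝ) : ContDiff ℝ 1 (Γ.ext f) := by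
  have : (Γ.ext f : (N → Vec 𝒜) → ℝ) = fun p => ∑ y : Γ.Joint, f y * ∏ j, p j (y j : 𝒜) :=
    funext (Γ.ext_apply f)
  rw [this]
  refine ContDiff.sum fun y _ => contDiff_const.mul (contDiff_prod fun j _ => ?_)
  exact (EuclideanSpace.proj (𝕜 := ℝ) (y j : 𝒜)).contDiff.comp (contDiff_apply ℝ (Vec 𝒜) j)

theorem continuous_ext (Γ : Game N 𝒜) (f : Γ.Joint → ℝ) : Continuous (Γ.ext f) :=
  (Γ.contDiff_ext f).continuous

/-- Radius `2` leaves room for estimates within distance `1` of a profile of norm at most `1`. -/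
theorem exists_lipschitz_ext (Γ : Game N 𝒜) (f : Γ.Joint → ℝ) :
    ∃ L, 0 ≤ L ∧ ∀ p p' : N → Vec 𝒜, ‖p‖ ≤ 2 → ‖p'‖ ≤ 2 →
      |Γ.ext f p - Γ.ext f p'| ≤ L * ‖p - p'‖ := by
  obtain ⟨L, hL⟩ := (Γ.contDiff_ext f).contDiffOn.exists_lipschitzOnWith one_ne_zero
    (convex_closedBall (0 : N → Vec 𝒜) 2) (isCompact_closedBall _ _)
  refine ⟨L, L.2, fun p p' hp hp' => ?_⟩
  have := hL.dist_le_mul p (by simpa using hp) p' (by simpa using hp')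
  rwa [Real.dist_eq, dist_eq_norm] at this

theorem ext_congr (Γ : Game N 𝒜) (f : Γ.Joint → ℝ) {p p' : N → Vec 𝒜}
    (h : ∀ i, ∀ a ∈ Γ.Y i, p i a = p' i a) : Γ.ext f p = Γ.ext f p' := by
  simp only [ext_apply]
  refine Finset.sum_congr rfl fun y _ => ?_
  congr 1
  exact Finset.prod_congr rfl fun j _ => h j _ (y j).2

/-- Only the coordinates in `Γ.Y i` enter, so even an arbitrary vector `g` may be replaced by a
combination of vertices. -/
theorem ext_update_eq_sum (Γ : Game N 𝒜) (f : Γ.Joint → ℝ) (p : N → Vec 𝒜) (i : N) (g : Vec 𝒜) :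
    Γ.ext f (Function.update p i g) =
      ∑ α : Γ.Y i, g α * Γ.ext f (Function.update p i (Γ.vertex α)) := by
  have h : Γ.ext f (Function.update p i g) =
      Γ.ext f (Function.update p i (∑ α : Γ.Y i, g α • Γ.vertex α)) := by
    refine Γ.ext_congr f fun j a ha => ?_
    rcases eq_or_ne j i with rfl | hj
    · have : ∀ α : Γ.Y j, a = α ↔ α = ⟨a, ha⟩ := fun α => by
        rw [Subtype.ext_iff, eq_comm]
      rw [Function.update_self, Function.update_self, WithLp.ofLp_sum, Finset.sum_apply]
      simp only [vertex, PiLp.smul_apply, PiLp.single_apply, this, smul_eq_mul, mul_ite, mul_one,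
        mul_zero, Finset.sum_ite_eq', Finset.mem_univ, if_true]
    · simp [hj]
  rw [h, MultilinearMap.map_update_sum]
  simp only [MultilinearMap.map_update_smul, smul_eq_mul]

/-- Swapping `α` and `β` in coordinate `i` permutes the joint actions, preserves `c`, and turns one
product into the other. -/
theorem ext_update_vertex_eq (Γ : Game N 𝒜) {c : Γ.Joint → ℝ} {i : N}
    (hc : ∀ (y : Γ.Joint) (b : Γ.Y i), c (Function.update y i b) = c y) (p : N → Vec 𝒜)
    (α β : Γ.Y i) :
    Γ.ext c (Function.update p i (Γ.vertex α)) = Γ.ext c (Function.update p i (Γ.vertex β)) := by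
  have hinv : Function.Involutive
      fun y : Γ.Joint => Function.update y i (Equiv.swap α β (y i)) := by
    intro y
    simp
  simp only [ext_apply]
  rw [← Equiv.sum_comp hinv.toPerm]
  refine Finset.sum_congr rfl fun y _ => ?_
  simp only [Function.Involutive.coe_toPerm, hc]
  congr 1
  refine Finset.prod_congr rfl fun j _ => ?_
  rcases eq_or_ne j i with rfl | hj
  · have : (Equiv.swap α β (y j) = α) ↔ (y j = β) := by
      rw [Equiv.swap_apply_eq_iff, Equiv.swap_apply_left]
    simp only [Function.update_self, vertex, PiLp.single_apply, ← Subtype.ext_iff, this]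
  · simp [hj]

variable {Γ : Game N 𝒜} {Φ : Γ.Joint → ℝ}

/-- Unilateral deviations change the utility and the potential by the same amount, for arbitrary
vectors in place of the strategies of the other players. -/
theorem IsPotential.U_update_sub (hΦ : Γ.IsPotential Φ) (i : N) (p : N → Vec 𝒜)
    (g g' : Vec 𝒜) (h : ∑ α : Γ.Y i, g α = ∑ α : Γ.Y i, g' α) :
    Γ.U i (Function.update p i g) - Γ.U i (Function.update p i g') =
      Γ.ext Φ (Function.update p i g) - Γ.ext Φ (Function.update p i g') := by
  -- The function `u i - Φ` does not depend on the action of `i`, so its extension depends on the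
  -- vector in slot `i` only through its coordinate sum over `Γ.Y i`.
  have hsub : ∀ x, Γ.ext (fun y => Γ.u i y - Φ y) x = Γ.U i x - Γ.ext Φ x := fun x => by
    simp only [U_eq_ext, ext_apply, sub_mul, Finset.sum_sub_distrib]
  have hc : ∀ (y : Γ.Joint) (b : Γ.Y i), (fun y => Γ.u i y - Φ y) (Function.update y i b) =
      (fun y => Γ.u i y - Φ y) y := fun y b => by
    have := hΦ i y b (y i)
    rw [Function.update_eq_self] at this
    simp only
    linarith
  suffices H : Γ.ext (fun y => Γ.u i y - Φ y) (Function.update p i g) =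
      Γ.ext (fun y => Γ.u i y - Φ y) (Function.update p i g') by
    rw [hsub, hsub] at H
    linarith
  rw [ext_update_eq_sum, ext_update_eq_sum _ _ _ _ g']
  rcases isEmpty_or_nonempty (Γ.Y i) with he | ⟨⟨β⟩⟩
  · simp
  · have hβ := fun α => Γ.ext_update_vertex_eq (c := fun y => Γ.u i y - Φ y) hc p α β
    simp only [hβ, ← Finset.sum_mul, h]

theorem mem_simplex_iff {i : N} {p : Vec 𝒜} : p ∈ Γ.simplex i ↔
    (∀ a, 0 ≤ p a) ∧ (∀ a, a ∉ Γ.Y i → p a = 0) ∧ ∑ α : Γ.Y i, p α = 1 := by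
  rw [simplex, Set.mem_ofPred_eq, Finset.sum_coe_sort (Γ.Y i) fun a => p a]

theorem vertex_mem_simplex {i : N} (α : Γ.Y i) : Γ.vertex α ∈ Γ.simplex i := by
  refine ⟨fun a => ?_, fun a ha => ?_, ?_⟩
  · simp only [vertex, PiLp.single_apply]
    split_ifs <;> simp
  · have : a ≠ α := fun h => ha (h ▸ α.2)
    simp [vertex, this]
  · simp [vertex]

theorem convex_simplex (i : N) : Convex ℝ (Γ.simplex i) := by
  intro p hp r hr b c hb hc hbc
  refine ⟨fun a => ?_, fun a ha => ?_, ?_⟩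
  · simpa using add_nonneg (mul_nonneg hb (hp.1 a)) (mul_nonneg hc (hr.1 a))
  · simp [hp.2.1 a ha, hr.2.1 a ha]
  · simp [Finset.sum_add_distrib, ← Finset.mul_sum, hp.2.2, hr.2.2, hbc]

theorem norm_le_one_of_mem_simplex {i : N} {p : Vec 𝒜} (hp : p ∈ Γ.simplex i) : ‖p‖ ≤ 1 := by
  have hsum : ∑ a, p a = 1 := by
    rw [← hp.2.2]
    exact (Finset.sum_subset (Finset.subset_univ _) fun a _ ha => hp.2.1 a ha).symm
  have hle : ∀ a, p a ≤ 1 := fun a =>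
    hsum ▸ Finset.single_le_sum (fun b _ => hp.1 b) (Finset.mem_univ a)
  rw [EuclideanSpace.norm_eq, Real.sqrt_le_one, ← hsum]
  refine Finset.sum_le_sum fun a _ => ?_
  rw [Real.norm_of_nonneg (hp.1 a)]
  nlinarith [hp.1 a, hle a]

theorem isClosed_simplex (Γ : Game N 𝒜) (i : N) : IsClosed (Γ.simplex i) := by
  have hc : ∀ a, Continuous fun p : Vec 𝒜 => p a := fun a =>
    (EuclideanSpace.proj (𝕜 := ℝ) a).continuous
  simp only [simplex, Set.ofPred_and, Set.ofPred_forall]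
  refine (isClosed_iInter fun a => isClosed_le continuous_const (hc a)).inter
    ((isClosed_iInter fun a => isClosed_iInter fun _ => isClosed_eq (hc a) continuous_const).inter
      (isClosed_eq (continuous_finsetSum _ fun a _ => hc a) continuous_const))

/-- Some vertex is at least as good as a given point of the simplex. -/
theorem ext_le_of_forall_vertex_le {f : Γ.Joint → ℝ} {p : N → Vec 𝒜} {i : N} {g : Vec 𝒜}
    (hg : g ∈ Γ.simplex i) {c : ℝ}
    (h : ∀ α : Γ.Y i, Γ.ext f (Function.update p i (Γ.vertex α)) ≤ c) :
    Γ.ext f (Function.update p i g) ≤ c := by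
  have hs := (mem_simplex_iff.1 hg).2.2
  rw [ext_update_eq_sum]
  calc _ ≤ ∑ α : Γ.Y i, g α * c := by
        gcongr with α
        · exact hg.1 _
        · exact h α
    _ = c := by rw [← Finset.sum_mul, hs, one_mul]

theorem mem_NE_of_ext_le (hΦ : Γ.IsPotential Φ) {p : N → Vec 𝒜} (hp : ∀ i, p i ∈ Γ.simplex i)
    (h : ∀ i (α : Γ.Y i), Γ.ext Φ (Function.update p i (Γ.vertex α)) ≤ Γ.ext Φ p) :
    p ∈ Γ.NE := by
  refine ⟨hp, fun i g hg => ?_⟩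
  have h1 := hΦ.U_update_sub i p g (p i)
    ((mem_simplex_iff.1 hg).2.2.trans (mem_simplex_iff.1 (hp i)).2.2.symm)
  rw [Function.update_eq_self] at h1
  linarith [ext_le_of_forall_vertex_le hg (h i)]

theorem q_succ (a : ℕ → Γ.Joint) (t : ℕ) (i : N) :
    Γ.q a (t + 1) i = Γ.q a t i + ((t : ℝ) + 1)⁻¹ • (Γ.vertex (a (t + 1) i) - Γ.q a t i) := by
  -- At `t = 0` both sides vanish, so the recursion also holds from stage `0`, where `q` is the zero
  -- vector.
  have h : (t : ℝ) • Γ.q a t i = ∑ s ∈ Finset.Icc 1 t, Γ.vertex (a s i) := by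
    rcases eq_or_ne t 0 with rfl | ht
    · simp
    · rw [q, smul_inv_smul₀ (by exact_mod_cast ht)]
  have hp : (t : ℝ) + 1 ≠ 0 := by positivity
  rw [q, Finset.sum_Icc_succ_top (by omega), ← h]
  push_cast
  have : Γ.q a t i = ((t : ℝ) + 1)⁻¹ • ((t : ℝ) + 1) • Γ.q a t i := (inv_smul_smul₀ hp _).symm
  nth_rw 2 [this]
  rw [← smul_add]
  congr 1
  module

theorem q_mem_simplex (a : ℕ → Γ.Joint) {t : ℕ} (ht : 1 ≤ t) (i : N) :
    Γ.q a t i ∈ Γ.simplex i := by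
  rw [q, Finset.smul_sum]
  have : (t : ℝ) ≠ 0 := by positivity
  refine (convex_simplex i).sum_mem (fun _ _ => by positivity) ?_ fun _ _ => vertex_mem_simplex _
  simp [this]

/-! ### Symmetric profiles and class averages -/

namespace PermInvPartition

variable (P : Γ.PermInvPartition Φ I)

theorem mem_part_ψ (i : N) : i ∈ P.part (P.ψ i) := (P.ψ_eq_iff i _).1 rfl

theorem ψ_eq_of_mem {k : I} {i j : N} (hi : i ∈ P.part k) (hj : j ∈ P.part k) :
    P.ψ i = P.ψ j := by
  rw [(P.ψ_eq_iff i k).2 hi, (P.ψ_eq_iff j k).2 hj]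

theorem mem_part_ψ_comm {i j : N} : j ∈ P.part (P.ψ i) ↔ i ∈ P.part (P.ψ j) := by
  rw [← P.ψ_eq_iff, ← P.ψ_eq_iff, eq_comm]

theorem card_ne_zero (k : I) : ((P.part k).card : ℝ) ≠ 0 := by
  exact_mod_cast (Finset.card_pos.2 (P.nonempty k)).ne'

theorem simplex_eq {k : I} {i j : N} (hi : i ∈ P.part k) (hj : j ∈ P.part k) :
    Γ.simplex i = Γ.simplex j := by
  simp only [simplex, P.same_actions k i hi j hj]

/-- Replacing the strategy of either of two players of a class with the same strategy has the same
effect on the potential. -/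
theorem ext_update_eq {k : I} {i j : N} (hi : i ∈ P.part k) (hj : j ∈ P.part k)
    {p : N → Vec 𝒜} (hp : p i = p j) (x : Vec 𝒜) :
    Γ.ext Φ (Function.update p i x) = Γ.ext Φ (Function.update p j x) := by
  rcases eq_or_ne i j with rfl | hij
  · rfl
  have hY := P.same_actions k i hi j hj
  -- Exchanging the actions of `i` and `j` is an involution that preserves `Φ`. The sum is reindexed
  -- by it and each product by the transposition of `i` and `j`; `hp` matches the slots left
  -- unchanged.
  let e : Γ.Joint → Γ.Joint := fun y =>
    Function.update (Function.update y i ⟨y j, hY.symm ▸ (y j).2⟩) j ⟨y i, hY ▸ (y i).2⟩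
  have ei : ∀ y, (e y i : 𝒜) = y j := fun y => by simp [e, hij]
  have ej : ∀ y, (e y j : 𝒜) = y i := fun y => by simp [e]
  have el : ∀ y l, l ≠ i → l ≠ j → e y l = y l := fun y l h1 h2 => by simp [e, h1, h2]
  have hinv : Function.Involutive e := fun y => by
    funext l
    rcases eq_or_ne l i with rfl | hli
    · exact Subtype.ext ((ei _).trans (ej _))
    rcases eq_or_ne l j with rfl | hlj
    · exact Subtype.ext ((ej _).trans (ei _))
    · rw [el _ _ hli hlj, el _ _ hli hlj]
  simp only [ext_apply]
  rw [← Equiv.sum_comp hinv.toPerm]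
  refine Finset.sum_congr rfl fun y _ => ?_
  simp only [Function.Involutive.coe_toPerm]
  rw [P.invariant k i hi j hj y (e y) (ei y) (ej y) (el y), ← Equiv.prod_comp (Equiv.swap i j)]
  congr 1
  refine Finset.prod_congr rfl fun l _ => ?_
  rcases eq_or_ne l i with rfl | hli
  · rw [Equiv.swap_apply_left, ej, Function.update_of_ne hij.symm, Function.update_of_ne hij, hp]
  rcases eq_or_ne l j with rfl | hlj
  · rw [Equiv.swap_apply_right, ei, Function.update_self, Function.update_self]
  · rw [Equiv.swap_apply_of_ne_of_ne hli hlj, el _ _ hli hlj, Function.update_of_ne hli,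
      Function.update_of_ne hlj]

/-- The tuples of mixed strategies that are constant on the classes of the partition. -/
noncomputable def symmetricProfiles : Set (N → Vec 𝒜) :=
  {p | (∀ i, p i ∈ Γ.simplex i) ∧ ∀ k, ∀ i ∈ P.part k, ∀ j ∈ P.part k, p i = p j}

theorem norm_le_one {p : N → Vec 𝒜} (hp : p ∈ P.symmetricProfiles) : ‖p‖ ≤ 1 :=
  (pi_norm_le_iff_of_nonneg zero_le_one).2 fun i => norm_le_one_of_mem_simplex (hp.1 i)

theorem isCompact_symmetricProfiles : IsCompact P.symmetricProfiles := by
  refine (isCompact_closedBall (0 : N → Vec 𝒜) 1).of_isClosed_subset ?_ fun p hp => by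
    simpa using P.norm_le_one hp
  simp only [symmetricProfiles, Set.ofPred_and, Set.ofPred_forall]
  refine (isClosed_iInter fun i => (Γ.isClosed_simplex i).preimage (continuous_apply i)).inter
    (isClosed_iInter fun k => isClosed_iInter fun i => isClosed_iInter fun _ =>
      isClosed_iInter fun j => isClosed_iInter fun _ =>
        isClosed_eq (f := fun p : N → Vec 𝒜 => p i) (continuous_apply i) (continuous_apply j))

/-- The averages over the classes of the strategies `x i`. -/
noncomputable def classAverage (x : N → Vec 𝒜) (i : N) : Vec 𝒜 :=
  ((P.part (P.ψ i)).card : ℝ)⁻¹ • ∑ j ∈ P.part (P.ψ i), x j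

theorem composite_eq (a : ℕ → Γ.Joint) (t : ℕ) :
    P.composite a t = P.classAverage (Γ.q a t) := rfl

theorem classAverage_mem {x : N → Vec 𝒜} (hx : ∀ i, x i ∈ Γ.simplex i) :
    P.classAverage x ∈ P.symmetricProfiles := by
  refine ⟨fun i => ?_, fun k i hi j hj => ?_⟩
  · rw [classAverage, Finset.smul_sum]
    refine (convex_simplex i).sum_mem (fun _ _ => by positivity) ?_ fun j hj => ?_
    · simp [P.card_ne_zero]
    · rw [P.simplex_eq (P.mem_part_ψ i) hj]
      exact hx j
  · simp only [classAverage, P.ψ_eq_of_mem hi hj]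

/-- By linearity the term of `i` is an average of the values with `x j` in slot `i`, for `j` in the
class of `i`. Symmetry of `p` and invariance move `x j` to slot `j`. -/
theorem sum_ext_update_classAverage {p : N → Vec 𝒜} (hp : p ∈ P.symmetricProfiles)
    (x : N → Vec 𝒜) :
    ∑ i, Γ.ext Φ (Function.update p i (P.classAverage x i)) =
      ∑ i, Γ.ext Φ (Function.update p i (x i)) := by
  have h1 : ∀ i, Γ.ext Φ (Function.update p i (P.classAverage x i)) =
      ∑ j ∈ P.part (P.ψ i),
        ((P.part (P.ψ j)).card : ℝ)⁻¹ * Γ.ext Φ (Function.update p j (x j)) := fun i => by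
    rw [classAverage, MultilinearMap.map_update_smul, MultilinearMap.map_update_sum, smul_eq_mul,
      Finset.mul_sum]
    refine Finset.sum_congr rfl fun j hj => ?_
    have hi := P.mem_part_ψ i
    rw [P.ext_update_eq hi hj (hp.2 _ i hi j hj), P.ψ_eq_of_mem hi hj]
  simp only [h1]
  -- After the exchange of sums each `j` occurs once for every member of its class, which cancels
  -- the weight.
  rw [Finset.sum_comm' (t' := Finset.univ) (s' := fun j => P.part (P.ψ j))
    (fun i j => by simp [P.mem_part_ψ_comm])]
  refine Finset.sum_congr rfl fun j _ => ?_
  rw [Finset.sum_const, nsmul_eq_mul, mul_inv_cancel_left₀ (P.card_ne_zero _)]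

theorem composite_mem (a : ℕ → Γ.Joint) {t : ℕ} (ht : 1 ≤ t) :
    P.composite a t ∈ P.symmetricProfiles :=
  P.classAverage_mem fun i => q_mem_simplex a ht i

theorem norm_composite_le (a : ℕ → Γ.Joint) (t : ℕ) : ‖P.composite a t‖ ≤ 1 := by
  rcases Nat.eq_zero_or_pos t with rfl | ht
  · have : P.composite a 0 = 0 := by
      funext i
      simp [composite, centroid, q]
    simp [this]
  · exact P.norm_le_one (P.composite_mem a ht)

theorem composite_succ (a : ℕ → Γ.Joint) (t : ℕ) :
    P.composite a (t + 1) = P.composite a t +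
      ((t : ℝ) + 1)⁻¹ • (P.classAverage (fun i => Γ.vertex (a (t + 1) i)) - P.composite a t) := by
  funext i
  simp only [composite_eq, classAverage, q_succ, Pi.add_apply, Pi.smul_apply, Pi.sub_apply,
    Finset.sum_add_distrib, ← Finset.smul_sum, Finset.sum_sub_distrib]
  module

theorem norm_composite_succ_sub_le (a : ℕ → Γ.Joint) (t : ℕ) :
    ‖P.composite a (t + 1) - P.composite a t‖ ≤ 2 / (t + 1) := by
  have hr := P.norm_le_one (P.classAverage_mem fun i => vertex_mem_simplex (a (t + 1) i))
  rw [composite_succ, add_sub_cancel_left, norm_smul, Real.norm_of_nonneg (by positivity),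
    inv_mul_eq_div]
  gcongr
  exact (norm_sub_le _ _).trans (by linarith [P.norm_composite_le a t])

end PermInvPartition

end ECFP.Game

/-! ### Vanishing gains and convergence -/

namespace ECFP.Game

variable {N I 𝒜 : Type*} [Fintype N] [DecidableEq N] [Fintype 𝒜] [DecidableEq 𝒜]
variable {Γ : Game N 𝒜} {Φ : Γ.Joint → ℝ}

/-- What player `i` gains, in terms of the extension of `f`, from playing `α` instead of `p i`
(`0` in case of a loss). -/
noncomputable def gain (Γ : Game N 𝒜) (f : Γ.Joint → ℝ) (j : Σ i, Γ.Y i) (p : N → Vec 𝒜) : ℝ :=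
  max 0 (Γ.ext f (Function.update p j.1 (Γ.vertex j.2)) - Γ.ext f p)

theorem continuous_gain (f : Γ.Joint → ℝ) (j : Σ i, Γ.Y i) : Continuous (Γ.gain f j) :=
  continuous_const.max (((Γ.continuous_ext f).comp
    (continuous_id.update j.1 continuous_const)).sub (Γ.continuous_ext f))

theorem norm_update_vertex_le {p : N → Vec 𝒜} {R : ℝ} (hR : 1 ≤ R) (hp : ‖p‖ ≤ R) (i : N)
    (α : Γ.Y i) : ‖Function.update p i (Γ.vertex α)‖ ≤ R := by
  refine (pi_norm_le_iff_of_nonneg (zero_le_one.trans hR)).2 fun j => ?_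
  rcases eq_or_ne j i with rfl | hj
  · simpa using (norm_le_one_of_mem_simplex (vertex_mem_simplex α)).trans hR
  · simpa [hj] using (norm_le_pi_norm p j).trans hp

theorem norm_update_sub_update_le (p p' : N → Vec 𝒜) (i : N) (x : Vec 𝒜) :
    ‖Function.update p i x - Function.update p' i x‖ ≤ ‖p - p'‖ := by
  refine (pi_norm_le_iff_of_nonneg (norm_nonneg _)).2 fun j => ?_
  rcases eq_or_ne j i with rfl | hj
  · simp
  · simpa [hj] using norm_le_pi_norm (p - p') j

namespace PermInvPartition

variable (P : Γ.PermInvPartition Φ I)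

theorem SNE_of_gain_eq_zero (hΦ : Γ.IsPotential Φ) {p : N → Vec 𝒜}
    (hp : p ∈ P.symmetricProfiles) (h : ∀ j, Γ.gain Φ j p = 0) : p ∈ P.SNE := by
  refine ⟨mem_NE_of_ext_le hΦ hp.1 fun i α => ?_, hp.2⟩
  have := le_max_right 0 (Γ.ext Φ (Function.update p i (Γ.vertex α)) - Γ.ext Φ p)
  linarith [h ⟨i, α⟩, show Γ.gain Φ ⟨i, α⟩ p = max 0 _ from rfl]

/-- If the actions are best responses to estimates that approach the composite centroid
sufficiently fast, then no player gains in the limit from leaving the composite centroid. -/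
theorem tendsto_gain (hΦ : Γ.IsPotential Φ) (a : ℕ → Γ.Joint) (h : ℕ → N → N → Vec 𝒜)
    (h0 : ∀ i, Tendsto (fun t => ‖h t i - P.composite a t‖) atTop (nhds 0))
    (hs : ∀ i, Summable fun t : ℕ => ‖h t i - P.composite a t‖ * (1 / ((t : ℝ) + 1)))
    (hbr : ∀ᶠ t in atTop, ∀ (i : N) (α : Γ.Y i),
      Γ.U i (Function.update (h t i) i (Γ.vertex α)) ≤
        Γ.U i (Function.update (h t i) i (Γ.vertex (a (t + 1) i)))) (j : Σ i, Γ.Y i) :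
    Tendsto (fun t => Γ.gain Φ j (P.composite a t)) atTop (nhds 0) := by
  obtain ⟨L, hL0, hL⟩ := Γ.exists_lipschitz_ext Φ
  obtain ⟨C, hC⟩ := exists_le_map_add_smul (Γ.continuous_ext Φ)
  set V := Γ.ext Φ with hV
  set g := P.composite a with hg
  have hg1 : ∀ t, ‖g t‖ ≤ 1 := P.norm_composite_le a
  have hg2 : ∀ t, ‖g t‖ ≤ 2 := fun t => (hg1 t).trans one_le_two
  -- best responses to the estimates are almost best responses to the composite centroid
  have hnear : ∀ᶠ t in atTop, ∀ (i : N) (α : Γ.Y i),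
      V (Function.update (g t) i (Γ.vertex α)) ≤
        V (Function.update (g t) i (Γ.vertex (a (t + 1) i))) + 2 * L * ‖h t i - g t‖ := by
    -- Eventually the estimates lie in the ball of radius `2` where the Lipschitz bound holds.
    have hsmall : ∀ᶠ t in atTop, ∀ i, ‖h t i - g t‖ < 1 :=
      eventually_all.2 fun i => (h0 i).eventually (gt_mem_nhds one_pos)
    filter_upwards [hbr, hsmall] with t ht hst i α
    have hh : ‖h t i‖ ≤ 2 := by
      have := norm_add_le (h t i - g t) (g t)
      rw [sub_add_cancel] at this
      linarith [hst i, hg1 t]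
    have hpot := hΦ.U_update_sub i (h t i) (Γ.vertex α) (Γ.vertex (a (t + 1) i))
      ((mem_simplex_iff.1 (vertex_mem_simplex α)).2.2.trans
        (mem_simplex_iff.1 (vertex_mem_simplex (a (t + 1) i))).2.2.symm)
    have hlip : ∀ β : Γ.Y i, |V (Function.update (h t i) i (Γ.vertex β)) -
        V (Function.update (g t) i (Γ.vertex β))| ≤ L * ‖h t i - g t‖ := fun β =>
      (hL _ _ (norm_update_vertex_le one_le_two hh i β)
        (norm_update_vertex_le one_le_two (hg2 t) i β)).trans
        (mul_le_mul_of_nonneg_left (norm_update_sub_update_le _ _ _ _) hL0)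
    have h1 := abs_le.1 (hlip α)
    have h2 := abs_le.1 (hlip (a (t + 1) i))
    linarith [ht i α, h1.1, h2.2]
  -- A gain is a difference of two values of `V`, each changing by at most `L * (2 / (t + 1))`.
  refine tendsto_zero_of_summable_div (C := 4 * L) (fun t => le_max_left _ _) (fun t => ?_) ?_
  · have hd := P.norm_composite_succ_sub_le a t
    have h1 := (hL _ _ (norm_update_vertex_le one_le_two (hg2 (t + 1)) j.1 j.2)
        (norm_update_vertex_le one_le_two (hg2 t) j.1 j.2)).trans
        (mul_le_mul_of_nonneg_left ((norm_update_sub_update_le _ _ _ _).trans hd) hL0)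
    have h2 := (hL _ _ (hg2 (t + 1)) (hg2 t)).trans (mul_le_mul_of_nonneg_left hd hL0)
    refine (abs_max_sub_max_le_max _ _ _ _).trans (max_le ?_ ?_)
    · rw [sub_self, abs_zero]
      positivity
    · rw [sub_sub_sub_comm]
      refine (abs_sub _ _).trans ((add_le_add h1 h2).trans (le_of_eq ?_))
      ring
  · refine summable_of_le_increment (w := fun t => V (g t)) (B := |V 0| + L)
      (e := fun t : ℕ => 2 * L * ∑ i, ‖h t i - g t‖ * (1 / ((t : ℝ) + 1)) +
        C * (1 / ((t : ℝ) + 1) ^ 2))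
      (fun t => div_nonneg (le_max_left _ _) (by positivity)) (fun t => ?_) ?_ ?_
    · have h1 := hL (g t) 0 (hg2 t) (by simp)
      rw [sub_zero] at h1
      have h2 := mul_le_mul_of_nonneg_left (hg1 t) hL0
      linarith [le_abs_self (V (g t) - V 0), le_abs_self (V 0)]
    · refine ((summable_sum fun i _ => hs i).mul_left _).add (Summable.mul_left _ ?_)
      simpa using (summable_nat_add_iff 1).2 (Real.summable_one_div_nat_pow.2 one_lt_two)
    · filter_upwards [hnear, eventually_ge_atTop 1] with t ht h1t
      have hgm : g t ∈ P.symmetricProfiles := P.composite_mem a h1t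
      set r := P.classAverage fun i => Γ.vertex (a (t + 1) i) with hr
      have hr1 : ‖r‖ ≤ 1 := P.norm_le_one (P.classAverage_mem fun i => vertex_mem_simplex _)
      have hp : (0 : ℝ) < t + 1 := by positivity
      have hstep := hC (g t) r (hg1 t) hr1 ((t : ℝ) + 1)⁻¹ (by positivity)
        (inv_le_one_of_one_le₀ (by simp))
      rw [← P.composite_succ a t, Finset.sum_sub_distrib,
        P.sum_ext_update_classAverage hgm, ← Finset.sum_sub_distrib] at hstep
      -- The current strategy is no better than the best vertex, so each corrected term is
      -- nonnegative; a single gain is then bounded by the whole sum.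
      have hterm : ∀ i, 0 ≤ V (Function.update (g t) i (Γ.vertex (a (t + 1) i))) - V (g t) +
          2 * L * ‖h t i - g t‖ := fun i => by
        have := ext_le_of_forall_vertex_le (hgm.1 i) (ht i)
        rw [Function.update_eq_self] at this
        linarith
      have hsum : Γ.gain Φ j (g t) ≤
          ∑ i, (V (Function.update (g t) i (Γ.vertex (a (t + 1) i))) - V (g t) +
            2 * L * ‖h t i - g t‖) := by
        refine le_trans (max_le (hterm j.1) ?_)
          (Finset.single_le_sum (fun i _ => hterm i) (Finset.mem_univ j.1))
        linarith [ht j.1 j.2]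
      rw [Finset.sum_add_distrib, ← Finset.mul_sum] at hsum
      have := mul_le_mul_of_nonneg_left hsum (inv_nonneg.2 hp.le)
      rw [← Finset.sum_mul, div_eq_inv_mul, one_div, one_div, ← inv_pow]
      linarith

/-- If no player gains in the limit from leaving the composite centroid, then the composite
centroid approaches the symmetric equilibria. -/
theorem nonempty_and_tendsto_dist (hΦ : Γ.IsPotential Φ) (a : ℕ → Γ.Joint)
    (hgain : ∀ j, Tendsto (fun t => Γ.gain Φ j (P.composite a t)) atTop (nhds 0)) :
    P.SNE.Nonempty ∧ Tendsto (fun t => dist₂ (P.composite a t) P.SNE) atTop (nhds 0) := by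
  obtain ⟨⟨p, hp, hz⟩, hlim⟩ := tendsto_zero_of_isCompact P.isCompact_symmetricProfiles
    (eventually_atTop.2 ⟨1, fun t ht => P.composite_mem a ht⟩) (continuous_gain Φ) hgain
  refine ⟨⟨p, P.SNE_of_gain_eq_zero hΦ hp hz⟩, hlim (fun p => dist₂ p P.SNE) ?_ fun p hp hz => ?_⟩
  · exact (Metric.continuous_infDist_pt _).comp (PiLp.continuous_toLp 2 _)
  · exact Metric.infDist_zero_of_mem (P.SNE_of_gain_eq_zero hΦ hp hz)

theorem IsECFP.nonempty_and_tendsto_dist (hΦ : Γ.IsPotential Φ) {s : ℕ}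
    {ĝ : ℕ → N → I → Vec 𝒜} {a : ℕ → Γ.Joint} (hs : s = 0 ∨ s = 1)
    (hĝ : ∀ i k, (fun t : ℕ => ‖ĝ t i k - P.centroid a t k‖) =O[atTop]
        fun t : ℕ => Real.log t / t) (h : P.IsECFP s ĝ a) :
    P.SNE.Nonempty ∧ Tendsto (fun t => dist₂ (P.composite a t) P.SNE) atTop (nhds 0) := by
  refine P.nonempty_and_tendsto_dist hΦ a ?_
  have hO : ∀ i, (fun t => ‖(fun j => ĝ t i (P.ψ j)) - P.composite a t‖) =O[atTop]
      fun t : ℕ => Real.log t / t := fun i =>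
    (isBigO_pi.2 fun j => (hĝ i (P.ψ j)).of_norm_left).norm_left
  have hlim : ∀ i, Tendsto (fun t => ‖(fun j => ĝ t i (P.ψ j)) - P.composite a t‖) atTop (nhds 0) :=
    fun i => (hO i).trans_tendsto tendsto_log_div
  have hsum : ∀ i, Summable fun t : ℕ =>
      ‖(fun j => ĝ t i (P.ψ j)) - P.composite a t‖ * (1 / ((t : ℝ) + 1)) := fun i =>
    summable_of_isBigO_nat summable_log_div_mul ((hO i).mul (isBigO_refl _ _))
  rcases hs with rfl | rfl
  -- For `s = 0` the action of stage `t + 1` responds to estimates of that stage. They serve as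
  -- estimates of the centroid at `t`, at the cost of its displacement `2 / (t + 1)`, which is
  -- summable against `1/t`.
  · have hle : ∀ i t, ‖(fun j => ĝ (t + 1) i (P.ψ j)) - P.composite a t‖ ≤
        ‖(fun j => ĝ (t + 1) i (P.ψ j)) - P.composite a (t + 1)‖ + 2 * (1 / ((t : ℝ) + 1)) :=
      fun i t => by
        have h1 := norm_add_le ((fun j => ĝ (t + 1) i (P.ψ j)) - P.composite a (t + 1))
          (P.composite a (t + 1) - P.composite a t)
        rw [sub_add_sub_cancel] at h1
        have h2 := P.norm_composite_succ_sub_le a t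
        rw [mul_one_div]
        linarith
    refine P.tendsto_gain hΦ a (fun t i j => ĝ (t + 1) i (P.ψ j)) (fun i => ?_) (fun i => ?_) ?_
    · refine squeeze_zero (fun _ => norm_nonneg _) (hle i) ?_
      have := ((hlim i).comp (tendsto_add_atTop_nat 1)).add
        ((tendsto_one_div_add_atTop_nhds_zero_nat (𝕜 := ℝ)).const_mul 2)
      simpa using this
    · have h1 := ((summable_nat_add_iff 1).2 (hsum i)).mul_left 2
      have h2 : Summable fun t : ℕ => 1 / ((t : ℝ) + 1) ^ 2 := by
        simpa using (summable_nat_add_iff 1).2 (Real.summable_one_div_nat_pow.2 one_lt_two)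
      refine Summable.of_nonneg_of_le (fun t => by positivity) (fun t => ?_)
        (h1.add (h2.mul_left 2))
      have hp : (0 : ℝ) < t + 1 := by positivity
      -- The shifted error series carries the weight `1 / (t + 2)`; a factor `2` restores `1 / (t +
      -- 1)`.
      have h3 : 1 / ((t : ℝ) + 1) ≤ 2 * (1 / (((t + 1 : ℕ) : ℝ) + 1)) := by
        push_cast
        rw [mul_one_div, div_le_div_iff₀ hp (by positivity)]
        linarith
      have h4 := mul_le_mul_of_nonneg_left h3
        (norm_nonneg ((fun j => ĝ (t + 1) i (P.ψ j)) - P.composite a (t + 1)))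
      have h5 := mul_le_mul_of_nonneg_right (hle i t) (one_div_nonneg.2 hp.le)
      have h6 : 1 / ((t : ℝ) + 1) ^ 2 = 1 / ((t : ℝ) + 1) * (1 / ((t : ℝ) + 1)) := by
        rw [sq, one_div_mul_one_div]
      rw [h6]
      linarith
    · exact Eventually.of_forall fun t => h (t + 1) (by omega)
  · exact P.tendsto_gain hΦ a (fun t i j => ĝ t i (P.ψ j)) hlim hsum
      (eventually_atTop.2 ⟨1, h⟩)

/-! ### Classical fictitious play as one player per class -/

/-- The partition into single players. -/
def singletons (Γ : Game N 𝒜) (Φ : Γ.Joint → ℝ) : Γ.PermInvPartition Φ N where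
  part i := {i}
  nonempty i := Finset.singleton_nonempty i
  disjoint i j h := Finset.disjoint_singleton.2 h
  cover i := ⟨i, Finset.mem_singleton_self i⟩
  same_actions k i hi j hj := by
    rw [Finset.mem_singleton.1 hi, Finset.mem_singleton.1 hj]
  invariant k i hi j hj y z h1 h2 h3 := by
    obtain rfl := Finset.mem_singleton.1 hi
    obtain rfl := Finset.mem_singleton.1 hj
    congr 1
    funext l
    rcases eq_or_ne l j with rfl | hl
    · exact Subtype.ext h1
    · exact h3 l hl hl

variable {P}

theorem part_ψ_eq_of_card (hP : ∀ k, (P.part k).card = 1) (i : N) : P.part (P.ψ i) = {i} := by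
  obtain ⟨j, hj⟩ := Finset.card_eq_one.1 (hP (P.ψ i))
  have := P.mem_part_ψ i
  rw [hj, Finset.mem_singleton] at this
  rw [hj, this]

theorem SNE_eq_of_card (hP : ∀ k, (P.part k).card = 1) : P.SNE = Γ.NE := by
  refine Set.Subset.antisymm (fun p hp => hp.1) fun p hp => ⟨hp, fun k i hi j hj => ?_⟩
  rw [Finset.card_le_one.1 (hP k).le i hi j hj]

theorem composite_eq_of_card (hP : ∀ k, (P.part k).card = 1) (a : ℕ → Γ.Joint) (t : ℕ) :
    P.composite a t = Γ.q a t := by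
  funext i
  simp [composite, centroid, part_ψ_eq_of_card hP i]

theorem isFP_iff_of_card (hP : ∀ k, (P.part k).card = 1) (a : ℕ → Γ.Joint) :
    Γ.IsFP a ↔ P.IsECFP 1 (fun t _ k => P.centroid a t k) a := by
  have h : ∀ t, (fun j => P.centroid a t (P.ψ j)) = Γ.q a t := composite_eq_of_card hP a
  simp only [IsFP, IsECFP, h]

end PermInvPartition

end ECFP.Game

theorem theorem4 {N I 𝒜 : Type*} [Fintype N] [DecidableEq N] [Fintype 𝒜] [DecidableEq 𝒜]
    (Γ : ECFP.Game N 𝒜) (Φ : Γ.Joint → ℝ) (hΦ : Γ.IsPotential Φ) :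
    -- convergence of every ECFP process
    (∀ (P : Γ.PermInvPartition Φ I) (s : ℕ) (ĝ : ℕ → N → I → ECFP.Vec 𝒜) (a : ℕ → Γ.Joint),
      (s = 0 ∨ s = 1) →
      (∀ i k, (fun t : ℕ => ‖ĝ t i k - P.centroid a t k‖) =O[atTop]
        fun t : ℕ => Real.log t / t) →
      P.IsECFP s ĝ a →
      P.SNE.Nonempty ∧
        Tendsto (fun t => ECFP.dist₂ (P.composite a t) P.SNE) atTop (nhds 0)) ∧
    -- classical fictitious play is the case of one player per class and exact estimates
    (∃ P : Γ.PermInvPartition Φ N, ∀ i, P.part i = {i}) ∧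
    (∀ P : Γ.PermInvPartition Φ I, (∀ k, (P.part k).card = 1) →
      P.SNE = Γ.NE ∧
      ∀ a : ℕ → Γ.Joint, (∀ t, P.composite a t = Γ.q a t) ∧
        (Γ.IsFP a ↔ P.IsECFP 1 (fun t _ k => P.centroid a t k) a)) ∧
    (∀ a : ℕ → Γ.Joint, Γ.IsFP a →
      Γ.NE.Nonempty ∧ Tendsto (fun t => ECFP.dist₂ (Γ.q a t) Γ.NE) atTop (nhds 0)) := by
  refine ⟨fun P s ĝ a hs hĝ h =>
      ECFP.Game.PermInvPartition.IsECFP.nonempty_and_tendsto_dist P hΦ hs hĝ h,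
    ⟨.singletons Γ Φ, fun _ => rfl⟩, fun P hP => ⟨P.SNE_eq_of_card hP, fun a =>
      ⟨P.composite_eq_of_card hP a, P.isFP_iff_of_card hP a⟩⟩, fun a ha => ?_⟩
  have hP : ∀ k, ((ECFP.Game.PermInvPartition.singletons Γ Φ).part k).card = 1 :=
    fun k => Finset.card_singleton k
  have h := ECFP.Game.PermInvPartition.IsECFP.nonempty_and_tendsto_dist _ hΦ (.inr rfl)
    (fun i k => by simpa using isBigO_zero _ _)
    ((ECFP.Game.PermInvPartition.isFP_iff_of_card hP a).1 ha)
  simpa only [ECFP.Game.PermInvPartition.SNE_eq_of_card hP,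
    ECFP.Game.PermInvPartition.composite_eq_of_card hP] using h
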